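/- Let $\Bbbk$ be a field of characteristic zero, let $n$ be a natural number, $I_n=\{1,\dots,n\}$, and let $p\colon I_n\to\mathbb Z_2$ be any parity function; put $p_{ij}:=p(i)+p(j)$. Let $q$ and $q_{ij}$ $(1\le i<j\le n)$ be independent indeterminates, and set $q_{ii}:=1$ and $q_{ji}:=q_{ij}^{-1}$ for $i<j$. Let $\Bbbk[q^{\pm1},\mathbf q^{\pm1}]$ be the ring of Laurent polynomials over $\Bbbk$ in these indeterminates and $\Bbbk(q,\mathbf q)$ its field of fractions. For $s\in I_n$ put $q_s:=q^{(-1)^{p(s)}}$. Let $F_{\mathbf q}^{\mathrm{int}}[ML_n^p]$ be the unital associative $\Bbbk[q^{\pm1},\mathbf q^{\pm1}]$-algebra (the algebra underlying the integral multiparametric quantum function superbialgebra, in which $x_{ij}$ has parity $p_{ij}$) with generators $x_{ij}$ $(i,j\in I_n)$ and relations $$\begin{aligned} x_{ij}^2&=0 && (p_{ij}=\bar1),\\ x_{ij}x_{ik}&=(-1)^{p_{ij}p_{ik}}\,q_i\,q_{jk}^{-1}\,x_{ik}x_{ij} && (j<k),\\ x_{ij}x_{hj}&=(-1)^{p_{ij}p_{hj}}\,q_j\,q_{ih}\,x_{hj}x_{ij}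 && (i<h),\\ x_{ij}x_{hk}&=(-1)^{p_{ij}p_{hk}}\,q_{ih}\,q_{jk}^{-1}\,x_{hk}x_{ij} && (i<h,\ j>k),\\ x_{ij}x_{hk}&=(-1)^{p_{ij}p_{hk}}\,q_{ih}\,q_{jk}^{-1}\,x_{hk}x_{ij}+(-1)^{p_{ij}p_{ik}}\,(q_i-q_i^{-1})\,q_{jk}^{-1}\,x_{ik}x_{hj} && (i<h,\ j<k), \end{aligned}$$ and let $F_{\mathbf q}[ML_n^p]:=\Bbbk(q,\mathbf q)\otimes_{\Bbbk[q^{\pm1},\mathbf q^{\pm1}]}F_{\mathbf q}^{\mathrm{int}}[ML_n^p]$ be its rational version. Fix any total order on the set of (indices of the) generators $x_{ij}$. Then the truncated ordered monomials $$\mathbb B=\Big\{\ \overrightarrow{\prod_{i,j\in I_n}}x_{ij}^{\,e_{ij}}\ \Big|\ e_{ij}\in\mathbb N\ \ \forall\, i,j\in I_n,\quad e_{ij}\le1\ \text{ if } p_{ij}=\bar1\Big\},$$ where the factors are multiplied in increasing order (and different exponent families give different monomials), form a $\Bbbk[q^{\pm1},\mathbf q^{\pm1}]$-basis of $F_{\mathbf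 q}^{\mathrm{int}}[ML_n^p]$. In particular, the $\Bbbk[q^{\pm1},\mathbf q^{\pm1}]$-module $F_{\mathbf q}^{\mathrm{int}}[ML_n^p]$ is free. Likewise, (the image of) $\mathbb B$ is a $\Bbbk(q,\mathbf q)$-basis of $F_{\mathbf q}[ML_n^p]$. -/

import Mathlib

open scoped TensorProduct

noncomputable section

namespace QMat

/-- The indeterminates: `none` stands for `q`, and `some ⟨(i, j), _⟩` for `q_{ij}` with `i < j`. -/
abbrev Param (n : ℕ) : Type := Option {s : Fin n × Fin n // s.1 < s.2}

/-- The Laurent polynomial ring `k[q^{±1}, 𝐪^{±1}]` in the indeterminates `q` and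
`q_{ij}`, `i < j`: the group algebra of the free abelian group on the indeterminates. -/
abbrev LRing (k : Type*) [Field k] (n : ℕ) : Type _ := AddMonoidAlgebra k (Param n →₀ ℤ)

/-- The field of fractions `k(q, 𝐪)` of `k[q^{±1}, 𝐪^{±1}]`. -/
abbrev LField (k : Type*) [Field k] (n : ℕ) : Type _ := FractionRing (LRing k n)

/-- The exponent vector of `q_{ij}` for arbitrary `i, j`; the matrix of parameters is
antisymmetric in the multiplicative sense, `q_{ii} = 1` and `q_{ji} = q_{ij}^{-1}`. -/
def paramExp {n : ℕ} (i j : Fin n) : Param n →₀ ℤ :=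
  if h : i < j then Finsupp.single (some ⟨(i, j), h⟩) 1
  else if h : j < i then -Finsupp.single (some ⟨(j, i), h⟩) 1
  else 0

/-- The element `q_{ij}^m` of `k[q^{±1}, 𝐪^{±1}]`, for `m : ℤ`. -/
def qq (k : Type*) [Field k] {n : ℕ} (i j : Fin n) (m : ℤ) : LRing k n :=
  AddMonoidAlgebra.single (m • paramExp i j) 1

/-- The sign `(-1)^a`, as an integer, for a parity `a ∈ ℤ/2`. -/
def sgn (a : ZMod 2) : ℤ := if a = 0 then 1 else -1

/-- The element `q_s^m` of `k[q^{±1}, 𝐪^{±1}]`, for `m : ℤ`, where `q_s = q^{(-1)^{p(s)}}`. -/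
def qs (k : Type*) [Field k] {n : ℕ} (p : Fin n → ZMod 2) (s : Fin n) (m : ℤ) : LRing k n :=
  AddMonoidAlgebra.single (Finsupp.single none (m * sgn (p s))) 1

/-- The parity `p_{ij} = p(i) + p(j)`. -/
def par {n : ℕ} (p : Fin n → ZMod 2) (i j : Fin n) : ZMod 2 := p i + p j

/-- The sign `(-1)^a` in `k[q^{±1}, 𝐪^{±1}]`. -/
def sg (k : Type*) [Field k] (n : ℕ) (a : ZMod 2) : LRing k n := ((sgn a : ℤ) : LRing k n)

/-- The free associative unital algebra over `k[q^{±1}, 𝐪^{±1}]` on the symbols `x_{ij}`. -/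
abbrev Free (k : Type*) [Field k] (n : ℕ) : Type _ := FreeAlgebra (LRing k n) (Fin n × Fin n)

/-- The free generator `x_{ij}`. -/
def X (k : Type*) [Field k] {n : ℕ} (i j : Fin n) : Free k n :=
  FreeAlgebra.ι (LRing k n) (i, j)

/-- The defining relations of the integral multiparametric quantum function superalgebra. -/
inductive Rel (k : Type*) [Field k] {n : ℕ} (p : Fin n → ZMod 2) : Free k n → Free k n → Prop
  | sq (i j : Fin n) (hp : par p i j = 1) :
      Rel k p (X k i j ^ 2) 0
  | row (i j h : Fin n) (hjh : j < h) :
      Rel k p (X k i j * X k i h)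
        ((sg k n (par p i j * par p i h) * qs k p i 1 * qq k j h (-1)) • (X k i h * X k i j))
  | col (i h j : Fin n) (hih : i < h) :
      Rel k p (X k i j * X k h j)
        ((sg k n (par p i j * par p h j) * qs k p j 1 * qq k i h 1) • (X k h j * X k i j))
  | anti (i j h l : Fin n) (hih : i < h) (hlj : l < j) :
      Rel k p (X k i j * X k h l)
        ((sg k n (par p i j * par p h l) * qq k i h 1 * qq k j l (-1)) • (X k h l * X k i j))
  | diag (i j h l : Fin n) (hih : i < h) (hjl : j < l) :
      Rel k p (X k i j * X k h l)
        ((sg k n (par p i j * par p h l) * qq k i h 1 * qq k j l (-1)) • (X k h l * X k i j)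
          + (sg k n (par p i j * par p i l) * (qs k p i 1 - qs k p i (-1)) * qq k j l (-1)) •
              (X k i l * X k h j))

/-- The (algebra underlying the) integral multiparametric quantum function superalgebra
`F_𝐪^int[ML_n^p]`, presented by generators and relations over `k[q^{±1}, 𝐪^{±1}]`. -/
abbrev FInt (k : Type*) [Field k] {n : ℕ} (p : Fin n → ZMod 2) : Type _ := RingQuot (Rel k p)

/-- The rational multiparametric quantum function superalgebra `F_𝐪[ML_n^p]`, the scalar
extension of `F_𝐪^int[ML_n^p]` to `k(q, 𝐪)`. -/
abbrev FRat (k : Type*) [Field k] {n : ℕ} (p : Fin n → ZMod 2) : Type _ :=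
  LField k n ⊗[LRing k n] FInt k p

/-- The generator `x_{ij}` of `F_𝐪^int[ML_n^p]`, indexed by the pair `(i, j)`. -/
def gen (k : Type*) [Field k] {n : ℕ} (p : Fin n → ZMod 2) (s : Fin n × Fin n) : FInt k p :=
  RingQuot.mkAlgHom (LRing k n) (Rel k p) (X k s.1 s.2)

/-- The product of the `y s ^ e s` over all `s`, taken in the increasing order given by `ord`. -/
def orderedProd {ι M : Type*} [Fintype ι] [Monoid M] (ord : LinearOrder ι)
    (y : ι → M) (e : ι → ℕ) : M :=
  ((Finset.univ.sort (fun a b : ι => a ≤ b)).map (fun s => y s ^ e s)).prod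

/-- The truncated exponents: `e_{ij} ∈ ℕ` for all `i, j`, with `e_{ij} ≤ 1` if `p_{ij} = 1`. -/
def TruncExp {n : ℕ} (p : Fin n → ZMod 2) : Type :=
  {e : Fin n × Fin n → ℕ // ∀ i j, par p i j = 1 → e (i, j) ≤ 1}

/-- The truncated ordered monomial in the generators `x_{ij}` with given exponents. -/
def monomial (k : Type*) [Field k] {n : ℕ} (p : Fin n → ZMod 2)
    (ord : LinearOrder (Fin n × Fin n)) (e : TruncExp p) : FInt k p :=
  orderedProd ord (gen k p) e.1

end QMat

end

/-! Spanning is a straightening argument. Give `x_ij` the weight `i * j`. The only relation with a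
correction term replaces `x_ij x_hl` by `x_il x_hj`, which is lighter by `(h - i)(l - j) > 0`. So
modulo lighter words every word is a multiple of each of its rearrangements, and a word with a
repeated odd letter is a combination of lighter words (`wordProd_mem_span`).

Independence needs enough functionals. The defining relations are RTT relations: they hold for a
function of the row and column sequences, up to a sign, as soon as the `R`-matrix acting on rows and
the one acting on columns agree on it (`wordFun_mem_relFun`), and such a function yields a linear
functional on the algebra (`functional`). The two `R`-matrices give commuting Hecke actions with the
same parameter `q - q⁻¹`, so the sum of the `T_w ⊗ T_w` over the symmetric group turns any function
into one on which they agree (`exists_agree`).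

When all indeterminates become `1`, this sum is over signed simultaneous permutations of rows and
columns. Start it from a signed indicator of a word without repeated odd letters: all contributions
at a given word then have the same sign, so in characteristic zero the functional survives at the
chosen word, and it vanishes on words that are not its rearrangements (`exists_relFun`). The matrix
of functionals against ordered monomials thus specializes to an invertible diagonal one, so its
determinant is nonzero already over the Laurent ring (`linearIndependent_of_specialization`). Only
letter multiplicities matter, so the total order is arbitrary. The rational statement is base
change. -/

noncomputable section

namespace QMat

/-! ### Straightening of words by a weight filtration. -/

section Words

variable {ι R A : Type*} [CommRing R] [Ring A] [Algebra R A]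

/-- The product of the `y s` along a word. -/
def wordProd {M : Type*} [Monoid M] (y : ι → M) (l : List ι) : M := (l.map y).prod

/-- The weight of a word. -/
def wordWeight (w : ι → ℕ) (l : List ι) : ℕ := (l.map w).sum

/-- The span of the words of weight less than `N`. -/
def lowSpan (R : Type*) [CommRing R] {A : Type*} [Ring A] [Algebra R A]
    (y : ι → A) (w : ι → ℕ) (N : ℕ) : Submodule R A :=
  Submodule.span R {a | ∃ l, wordWeight w l < N ∧ wordProd y l = a}

lemma wordProd_cons {M : Type*} [Monoid M] (y : ι → M) (s : ι) (l : List ι) :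
    wordProd y (s :: l) = y s * wordProd y l := by simp [wordProd]

lemma wordProd_append {M : Type*} [Monoid M] (y : ι → M) (l m : List ι) :
    wordProd y (l ++ m) = wordProd y l * wordProd y m := by simp [wordProd]

lemma wordWeight_append (w : ι → ℕ) (l m : List ι) :
    wordWeight w (l ++ m) = wordWeight w l + wordWeight w m := by simp [wordWeight]

lemma wordWeight_perm (w : ι → ℕ) {l m : List ι} (h : l.Perm m) :
    wordWeight w l = wordWeight w m := (h.map w).sum_eq

lemma mul_mem_lowSpan (y : ι → A) (w : ι → ℕ) (u v : List ι) {N : ℕ} {a : A}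
    (ha : a ∈ lowSpan R y w N) :
    wordProd y u * a * wordProd y v ∈
      lowSpan R y w (wordWeight w u + N + wordWeight w v) := by
  induction ha using Submodule.span_induction with
  | mem x hx =>
    obtain ⟨l, hl, rfl⟩ := hx
    refine Submodule.subset_span ⟨u ++ l ++ v, ?_, ?_⟩
    · simp only [wordWeight_append]; omega
    · simp only [wordProd_append]
  | zero => simp
  | add x z _ _ hx hz =>
    rw [mul_add, add_mul]; exact add_mem hx hz
  | smul c x _ hx =>
    rw [mul_smul_comm, smul_mul_assoc]; exact Submodule.smul_mem _ _ hx

/-- If the generators commute up to scalars and terms of lower weight, then so do the letters of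
any word. -/
lemma exists_wordProd_sub_mem_lowSpan (y : ι → A) (w : ι → ℕ)
    (hy : ∀ s t, ∃ c : R, y s * y t - c • (y t * y s) ∈ lowSpan R y w (w s + w t))
    {l m : List ι} (h : l.Perm m) :
    ∃ c : R, wordProd y l - c • wordProd y m ∈ lowSpan R y w (wordWeight w l) := by
  induction h with
  | nil => exact ⟨1, by simp⟩
  | @cons x l₁ l₂ _ ih =>
    obtain ⟨c, hc⟩ := ih
    refine ⟨c, ?_⟩
    have := mul_mem_lowSpan y w [x] [] hc
    simpa [wordProd, wordWeight, mul_sub] using this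
  | swap x z l =>
    obtain ⟨c, hc⟩ := hy z x
    refine ⟨c, ?_⟩
    have := mul_mem_lowSpan y w [] l hc
    simpa [wordProd, wordWeight, sub_mul, mul_assoc, add_assoc] using this
  | @trans l₁ l₂ l₃ h₁ _ ih₁ ih₂ =>
    obtain ⟨c, hc⟩ := ih₁
    obtain ⟨d, hd⟩ := ih₂
    rw [← wordWeight_perm w h₁] at hd
    refine ⟨c * d, ?_⟩
    have := add_mem hc (Submodule.smul_mem _ c hd)
    rwa [smul_sub, smul_smul, sub_add_sub_cancel] at this

/-- The increasing word in which each letter `s` occurs `e s` times. -/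
def expWord [Fintype ι] (ord : LinearOrder ι) (e : ι → ℕ) : List ι :=
  (Finset.univ.sort (fun a b : ι => a ≤ b)).flatMap (fun s => List.replicate (e s) s)

lemma orderedProd_eq_wordProd [Fintype ι] {M : Type*} [Monoid M] (ord : LinearOrder ι)
    (y : ι → M) (e : ι → ℕ) : orderedProd ord y e = wordProd y (expWord ord e) := by
  unfold orderedProd wordProd expWord
  induction Finset.univ.sort (fun a b : ι => a ≤ b) with
  | nil => simp
  | cons a l ih => simp [ih]

lemma count_expWord [Fintype ι] [BEq ι] [LawfulBEq ι] (ord : LinearOrder ι) (e : ι → ℕ) (s : ι) :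
    (expWord ord e).count s = e s := by
  unfold expWord
  have hnd := Finset.sort_nodup (Finset.univ : Finset ι) (fun a b : ι => a ≤ b)
  have hmem : s ∈ Finset.univ.sort (fun a b : ι => a ≤ b) := by simp
  revert hnd hmem
  induction Finset.univ.sort (fun a b : ι => a ≤ b) with
  | nil => simp
  | cons a l ih =>
    intro hnd hmem
    rw [List.nodup_cons] at hnd
    rw [List.flatMap_cons, List.count_append, List.count_replicate]
    by_cases h : a = s
    · subst h
      have : List.count a (l.flatMap fun s => List.replicate (e s) s) = 0 := by
        rw [List.count_eq_zero]
        simp only [List.mem_flatMap, List.mem_replicate, not_exists, not_and]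
        rintro x hx _ rfl
        exact hnd.1 hx
      simp [this]
    · have hs : s ∈ l := by
        rcases List.mem_cons.1 hmem with h' | h'
        · exact absurd h'.symm h
        · exact h'
      simp [h, ih hnd.2 hs]

lemma expWord_count_perm [Fintype ι] [DecidableEq ι] (ord : LinearOrder ι) (l : List ι) :
    l.Perm (expWord ord (fun s => l.count s)) := by
  rw [List.perm_iff_count]
  intro s
  rw [count_expWord]

lemma exists_perm_cons_cons [DecidableEq ι] {l : List ι} {s : ι} (h : 2 ≤ l.count s) :
    ∃ m, l.Perm (s :: s :: m) := by
  have h1 : s ∈ l := List.count_pos_iff.1 (by omega)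
  have h2 : s ∈ l.erase s := by
    apply List.count_pos_iff.1
    rw [List.count_erase_self]; omega
  exact ⟨_, (List.perm_cons_erase h1).trans ((List.perm_cons_erase h2).cons s)⟩

/-- Ordered truncated words span, if the generators commute up to scalars and terms of lower
weight, and the truncated ones have square zero. -/
lemma wordProd_mem_span [Fintype ι] [DecidableEq ι] (ord : LinearOrder ι)
    (y : ι → A) (w : ι → ℕ) (odd : Set ι)
    (hy : ∀ s t, ∃ c : R, y s * y t - c • (y t * y s) ∈ lowSpan R y w (w s + w t))
    (hodd : ∀ s ∈ odd, y s * y s = 0) (l : List ι) :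
    wordProd y l ∈ Submodule.span R
      {a | ∃ e : ι → ℕ, (∀ s ∈ odd, e s ≤ 1) ∧ wordProd y (expWord ord e) = a} := by
  induction hN : wordWeight w l using Nat.strong_induction_on generalizing l with
  | _ N ih =>
    subst hN
    have hlow : lowSpan R y w (wordWeight w l) ≤ Submodule.span R
        {a | ∃ e : ι → ℕ, (∀ s ∈ odd, e s ≤ 1) ∧ wordProd y (expWord ord e) = a} := by
      refine Submodule.span_le.2 ?_
      rintro _ ⟨m, hm, rfl⟩
      exact ih _ hm m rfl
    by_cases h : ∀ s ∈ odd, l.count s ≤ 1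
    · obtain ⟨c, hc⟩ := exists_wordProd_sub_mem_lowSpan y w hy (expWord_count_perm ord l)
      have := add_mem (hlow hc) (Submodule.smul_mem _ c (Submodule.subset_span
        ⟨fun s => l.count s, h, rfl⟩))
      simpa using this
    · push Not at h
      obtain ⟨s, hs, hs2⟩ := h
      -- Bring two copies of the odd letter together: the leading term then contains its square,
      -- which is zero, and only lighter words remain.
      obtain ⟨m, hm⟩ := exists_perm_cons_cons (l := l) (s := s) (by omega)
      obtain ⟨c, hc⟩ := exists_wordProd_sub_mem_lowSpan y w hy hm
      have h0 : wordProd y (s :: s :: m) = 0 := by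
        rw [wordProd_cons, wordProd_cons, ← mul_assoc, hodd s hs, zero_mul]
      rw [h0, smul_zero, sub_zero] at hc
      exact hlow hc

end Words

/-! ### Averaging over two commuting Hecke actions. -/

section Hecke

/-- The relations of the generators of the Hecke algebra of the symmetric group, with the
normalization `T² = 1 + z T`. -/
structure IsHecke {E : Type*} [Ring E] (T : ℕ → E) (z : E) : Prop where
  quad : ∀ i, T i * T i = 1 + z * T i
  braid : ∀ i, T i * T (i + 1) * T i = T (i + 1) * T i * T (i + 1)
  far : ∀ i j, i + 1 < j → T i * T j = T j * T i
  central : ∀ i, z * T i = T i * z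

variable {E M : Type*} [Ring E] [AddCommGroup M] [Module E M] {A B : ℕ → E} {z : E}

/-- For `j + 1 < k`, both `A j` and `B j` commute with every factor of `Z k = A k * B k * A (k+1) *
B (k+1) ⋯ Z N`, so they reach `Z N`, where they agree. -/
lemma chain_far (hA : IsHecke A z) (hB : IsHecke B z) (hAB : ∀ i j, A i * B j = B j * A i)
    {N : ℕ} {Z : ℕ → M} (hZ : ∀ k < N, Z k = (A k * B k) • Z (k + 1))
    (hN : ∀ j, j + 1 < N → A j • Z N = B j • Z N) {k : ℕ} (hk : k ≤ N) :
    ∀ j, j + 1 < k → A j • Z k = B j • Z k := by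
  induction hk using Nat.decreasingInduction with
  | self => exact hN
  | of_succ k hk ih =>
    intro j hj
    have e1 : A j * (A k * B k) = A k * B k * A j := by
      rw [← mul_assoc, hA.far j k hj, mul_assoc, hAB, ← mul_assoc]
    have e2 : B j * (A k * B k) = A k * B k * B j := by
      rw [← mul_assoc, ← hAB, mul_assoc, hB.far j k hj, ← mul_assoc]
    rw [hZ k hk, smul_smul, smul_smul, e1, e2, mul_smul, mul_smul _ (B j), ih j (by omega)]

/-- For `k < j`, the braid relation moves index `j` through the factors `j - 1` and `j`, turning it
into `j - 1`; the remaining vector is `Z (j+1)`, where `chain_far` applies. -/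
lemma chain_near (hA : IsHecke A z) (hB : IsHecke B z) (hAB : ∀ i j, A i * B j = B j * A i)
    {N : ℕ} {Z : ℕ → M} (hZ : ∀ k < N, Z k = (A k * B k) • Z (k + 1))
    (hN : ∀ j, j + 1 < N → A j • Z N = B j • Z N) {k : ℕ} (hk : k ≤ N) :
    ∀ j, k < j → j < N → A j • Z k = B j • Z k := by
  induction hk using Nat.decreasingInduction with
  | self => intro j h1 h2; omega
  | of_succ k hk ih =>
    intro j hj hjN
    rcases Nat.lt_or_ge (k + 1) j with h | h
    · have e1 : A j * (A k * B k) = A k * B k * A j := by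
        rw [← mul_assoc, ← hA.far k j h, mul_assoc, hAB, ← mul_assoc]
      have e2 : B j * (A k * B k) = A k * B k * B j := by
        rw [← mul_assoc, ← hAB, mul_assoc, ← hB.far k j h, ← mul_assoc]
      rw [hZ k hk, smul_smul, smul_smul, e1, e2, mul_smul, mul_smul _ (B j), ih j h hjN]
    · obtain rfl : j = k + 1 := by omega
      have e1 : A (k + 1) * (A k * B k * (A (k + 1) * B (k + 1))) =
          A k * B k * (A (k + 1) * B (k + 1)) * A k := by
        calc _ = A (k + 1) * A k * (B k * A (k + 1)) * B (k + 1) := by simp only [mul_assoc]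
          _ = (A (k + 1) * A k * A (k + 1)) * B k * B (k + 1) := by
            rw [← hAB]; simp only [mul_assoc]
          _ = A k * A (k + 1) * (A k * B k) * B (k + 1) := by
            rw [← hA.braid]; simp only [mul_assoc]
          _ = A k * (A (k + 1) * B k) * (A k * B (k + 1)) := by
            rw [hAB k k]; simp only [mul_assoc]
          _ = _ := by rw [hAB (k + 1) k, hAB k (k + 1)]; simp only [mul_assoc]
      have e2 : B (k + 1) * (A k * B k * (A (k + 1) * B (k + 1))) =
          A k * B k * (A (k + 1) * B (k + 1)) * B k := by
        calc _ = B (k + 1) * A k * (B k * A (k + 1)) * B (k + 1) := by simp only [mul_assoc]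
          _ = A k * (B (k + 1) * A (k + 1)) * B k * B (k + 1) := by
            rw [← hAB (k + 1) k, ← hAB k (k + 1)]; simp only [mul_assoc]
          _ = A k * A (k + 1) * (B (k + 1) * B k * B (k + 1)) := by
            rw [← hAB (k + 1) (k + 1)]; simp only [mul_assoc]
          _ = A k * (A (k + 1) * B k) * B (k + 1) * B k := by
            rw [← hB.braid]; simp only [mul_assoc]
          _ = _ := by rw [hAB (k + 1) k]; simp only [mul_assoc]
      rw [hZ k hk, hZ (k + 1) hjN, smul_smul (A k * B k), smul_smul, smul_smul, e1, e2, mul_smul,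
        mul_smul _ (B k), chain_far hA hB hAB hZ hN (k := k + 2) (by omega) k (by omega)]

/-- The relative trace: an element on which the first `N - 1` generators of two commuting Hecke
actions agree is promoted to one on which the first `N` agree. -/
lemma chain_sum (hA : IsHecke A z) (hB : IsHecke B z) (hAB : ∀ i j, A i * B j = B j * A i)
    {N : ℕ} {Z : ℕ → M} (hZ : ∀ k < N, Z k = (A k * B k) • Z (k + 1))
    (hN : ∀ j, j + 1 < N → A j • Z N = B j • Z N) (j : ℕ) (hj : j < N) :
    A j • ∑ k ∈ Finset.range (N + 1), Z k = B j • ∑ k ∈ Finset.range (N + 1), Z k := by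
  -- The neighbours `Z j` and `Z (j+1)` cancel as a pair, because the quadratic relations give `(A j
  -- - B j) * (A j * B j + 1) = 0`; the two actions agree on every other summand separately.
  have pair : (A j - B j) • Z j + (A j - B j) • Z (j + 1) = 0 := by
    rw [hZ j hj, smul_smul, ← add_smul]
    have : (A j - B j) * (A j * B j) + (A j - B j) = 0 := by
      have h1 : A j * (A j * B j) = B j + z * (A j * B j) := by
        rw [← mul_assoc, hA.quad, add_mul, one_mul, mul_assoc]
      have h2 : B j * (A j * B j) = A j + z * (A j * B j) := by
        rw [← mul_assoc, ← hAB, mul_assoc, hB.quad, mul_add, mul_one, ← mul_assoc, ← mul_assoc,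
          hA.central]
      rw [sub_mul, h1, h2]; abel
    rw [this, zero_smul]
  rw [← sub_eq_zero, ← sub_smul, Finset.smul_sum,
    ← Finset.add_sum_erase _ _ (Finset.mem_range.2 (by omega : j < N + 1)),
    ← Finset.add_sum_erase _ _ (Finset.mem_erase.2 ⟨by omega,
      Finset.mem_range.2 (by omega : j + 1 < N + 1)⟩), ← add_assoc, pair, zero_add]
  refine Finset.sum_eq_zero fun k hk => ?_
  simp only [Finset.mem_erase, Finset.mem_range] at hk
  rw [sub_smul, sub_eq_zero]
  rcases Nat.lt_or_ge j k with h | h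
  · exact chain_far hA hB hAB hZ hN (by omega) j (by omega)
  · exact chain_near hA hB hAB hZ hN (by omega) j (by omega) hj

/-- The averaging over the symmetric group: every `x` can be corrected to an element on which
two commuting Hecke actions agree. -/
lemma exists_agree (hA : IsHecke A z) (hB : IsHecke B z)
    (hAB : ∀ i j, A i * B j = B j * A i) (P : AddSubmonoid M) (N : ℕ)
    (hP : ∀ i < N, ∀ x ∈ P, (A i * B i) • x ∈ P) (x : M) (hx : x ∈ P) :
    ∃ y : M, (∀ j < N, A j • y = B j • y) ∧ y - x ∈ P := by
  induction N with
  | zero => exact ⟨x, by simp, by simp⟩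
  | succ N ih =>
    obtain ⟨y, hy, hyx⟩ := ih fun i hi => hP i (by omega)
    -- The products `s_k ⋯ s_N`, together with the identity, are the minimal coset representatives
    -- of one symmetric group in the next. `W` builds them from the right, and `Z` reindexes so that
    -- `Z (N+1) = y`.
    let W : ℕ → M := fun t => Nat.rec y (fun t v => (A (N - t) * B (N - t)) • v) t
    let Z : ℕ → M := fun k => W (N + 1 - k)
    have hZ : ∀ k < N + 1, Z k = (A k * B k) • Z (k + 1) := by
      intro k hk
      change W (N + 1 - k) = _ • W (N + 1 - (k + 1))
      obtain ⟨t, rfl⟩ : ∃ t, N = k + t := ⟨N - k, by omega⟩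
      rw [show k + t + 1 - k = t + 1 by omega, show k + t + 1 - (k + 1) = t by omega]
      change (A (k + t - t) * B (k + t - t)) • W t = _
      rw [show k + t - t = k by omega]
    have hZN : Z (N + 1) = y := by
      change W (N + 1 - (N + 1)) = y
      rw [Nat.sub_self]; rfl
    have hyP : y ∈ P := by
      have := add_mem hyx hx
      rwa [sub_add_cancel] at this
    have hZP : ∀ k ≤ N + 1, Z k ∈ P := by
      intro k hk
      induction hk using Nat.decreasingInduction with
      | self => rwa [hZN]
      | of_succ k hk ih' =>
        rw [hZ k hk]
        exact hP k hk _ ih'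
    refine ⟨∑ k ∈ Finset.range (N + 1 + 1), Z k, chain_sum hA hB hAB hZ ?_, ?_⟩
    · intro j hj
      rw [hZN]
      exact hy j (by omega)
    -- The identity coset contributes `y`, which is already `x` plus an element of `P`; all other
    -- cosets contribute elements of `P`.
    · rw [Finset.sum_range_succ, hZN, add_sub_assoc]
      exact add_mem (sum_mem fun k hk => hZP k (Finset.mem_range.1 hk).le) hyx

end Hecke

/-! ### The multiparametric `R`-matrix as a Hecke operator. -/

section RMatrix

lemma comp_swap_of_eq {ι : Type*} {s : ℕ → ι} {i j : ℕ} (h : s i = s j) : s ∘ Equiv.swap i j = s := by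
  funext t
  simp only [Function.comp_apply, Equiv.swap_apply_def]
  split_ifs with h1 h2
  · rw [h1, h]
  · rw [h2, h]
  · rfl

variable {ι L : Type*} [LinearOrder ι] [CommRing L]

/-- The coefficient of the flipped term in the `R`-matrix. -/
def flipCoeff (u : ι → ι → L) (lam : ι → L) (x y : ι) : L := if x = y then lam x else u x y

/-- The coefficient of the unflipped term in the `R`-matrix. -/
def stayCoeff (z : L) (x y : ι) : L := if x < y then z else 0

/-- The braid relation of the `R`-matrix, for functions of three letters. -/
lemma braid_triple {u : ι → ι → L} {lam : ι → L} {z : L} (hu : ∀ x y, x ≠ y → u x y * u y x = 1)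
    (hlam : ∀ x, lam x * lam x = 1 + z * lam x) (h : ι → ι → ι → L) (x y w : ι)
    (op₁ op₂ : (ι → ι → ι → L) → ι → ι → ι → L)
    (h₁ : ∀ h a b c, op₁ h a b c = flipCoeff u lam a b * h b a c + stayCoeff z a b * h a b c)
    (h₂ : ∀ h a b c, op₂ h a b c = flipCoeff u lam b c * h a c b + stayCoeff z b c * h a b c) :
    op₁ (op₂ (op₁ h)) x y w = op₂ (op₁ (op₂ h)) x y w := by
  simp only [h₁, h₂, flipCoeff, stayCoeff]
  have h1 := hlam x
  have h2 := hlam y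
  have h3 := hlam w
  have h4 := hu x y
  have h5 := hu x w
  have h6 := hu y w
  clear h₁ h₂ hlam hu op₁ op₂
  rcases lt_trichotomy x y with hxy | hxy | hxy <;>
  rcases lt_trichotomy y w with hyw | hyw | hyw <;>
  rcases lt_trichotomy x w with hxw | hxw | hxw <;>
  first
  | (exfalso; order)
  | grind (splits := 30)

variable (u : ι → ι → L) (lam : ι → L) (z : L)

/-- The action of the `R`-matrix on the letters at positions `i` and `i + 1`. -/
def rOp (i : ℕ) (g : (ℕ → ι) → L) (s : ℕ → ι) : L :=
  flipCoeff u lam (s i) (s (i + 1)) * g (s ∘ Equiv.swap i (i + 1)) +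
    stayCoeff z (s i) (s (i + 1)) * g s

variable {u lam z}

lemma rOp_quad (hu : ∀ x y, x ≠ y → u x y * u y x = 1)
    (hlam : ∀ x, lam x * lam x = 1 + z * lam x) (i : ℕ) (g : (ℕ → ι) → L) (s : ℕ → ι) :
    rOp u lam z i (rOp u lam z i g) s = g s + z * rOp u lam z i g s := by
  have hss : (s ∘ Equiv.swap i (i + 1)) ∘ Equiv.swap i (i + 1) = s := by
    funext t; simp
  simp only [rOp, hss, Function.comp_apply, Equiv.swap_apply_left, Equiv.swap_apply_right]
  have h1 := hlam (s i)
  have h2 := hu (s i) (s (i + 1))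
  have h3 : s i = s (i + 1) → s ∘ Equiv.swap i (i + 1) = s := comp_swap_of_eq
  simp only [flipCoeff, stayCoeff]
  generalize s ∘ Equiv.swap i (i + 1) = s' at *
  rcases lt_trichotomy (s i) (s (i + 1)) with h | h | h
  · simp only [h, h.ne, h.ne', h.not_gt, if_true, if_false]
    linear_combination (g s) * h2 h.ne
  · simp only [h3 h, h, lt_irrefl, if_true, if_false]
    rw [h] at h1
    linear_combination (g s) * h1
  · simp only [h, h.ne, h.ne', h.not_gt, if_true, if_false]
    linear_combination (g s) * h2 h.ne'

/-- The sequence `s` with the letters at positions `i`, `i + 1`, `i + 2` replaced. -/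
def place (i : ℕ) (s : ℕ → ι) (a b c : ι) (t : ℕ) : ι :=
  if t = i then a else if t = i + 1 then b else if t = i + 2 then c else s t

/-- Only positions `i`, `i + 1`, `i + 2` are moved; freezing the other letters with `place` reduces
the claim to `braid_triple`. -/
lemma rOp_braid (hu : ∀ x y, x ≠ y → u x y * u y x = 1)
    (hlam : ∀ x, lam x * lam x = 1 + z * lam x) (i : ℕ) (g : (ℕ → ι) → L) (s : ℕ → ι) :
    rOp u lam z i (rOp u lam z (i + 1) (rOp u lam z i g)) s =
      rOp u lam z (i + 1) (rOp u lam z i (rOp u lam z (i + 1) g)) s := by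
  have p₁ : ∀ a b c, place i s a b c ∘ Equiv.swap i (i + 1) = place i s b a c := by
    intro a b c; funext t
    simp only [Function.comp_apply, Equiv.swap_apply_def, place]
    grind
  have p₂ : ∀ a b c, place i s a b c ∘ Equiv.swap (i + 1) (i + 1 + 1) = place i s a c b := by
    intro a b c; funext t
    simp only [Function.comp_apply, Equiv.swap_apply_def, place]
    grind
  have ps : s = place i s (s i) (s (i + 1)) (s (i + 2)) := by
    funext t; simp only [place]; grind
  let op₁ : (ι → ι → ι → L) → ι → ι → ι → L := fun h a b c =>
    flipCoeff u lam a b * h b a c + stayCoeff z a b * h a b c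
  let op₂ : (ι → ι → ι → L) → ι → ι → ι → L := fun h a b c =>
    flipCoeff u lam b c * h a c b + stayCoeff z b c * h a b c
  have e₁ : ∀ g : (ℕ → ι) → L, (fun a b c => rOp u lam z i g (place i s a b c)) =
      op₁ (fun a b c => g (place i s a b c)) := by
    intro g; funext a b c
    simp only [rOp, p₁, op₁]
    simp [place]
  have e₂ : ∀ g : (ℕ → ι) → L, (fun a b c => rOp u lam z (i + 1) g (place i s a b c)) =
      op₂ (fun a b c => g (place i s a b c)) := by
    intro g; funext a b c
    simp only [rOp, p₂, op₂]
    simp [place, show i + 1 + 1 ≠ i by omega]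
  have key := braid_triple hu hlam (fun a b c => g (place i s a b c)) (s i) (s (i + 1)) (s (i + 2))
    op₁ op₂ (fun _ _ _ _ => rfl) (fun _ _ _ _ => rfl)
  rw [← e₁, ← e₂, ← e₁, ← e₂, ← e₁, ← e₂] at key
  beta_reduce at key
  rw [← ps] at key
  exact key

lemma rOp_far (i j : ℕ) (hij : i + 1 < j) (g : (ℕ → ι) → L) (s : ℕ → ι) :
    rOp u lam z i (rOp u lam z j g) s = rOp u lam z j (rOp u lam z i g) s := by
  have hc : (s ∘ Equiv.swap i (i + 1)) ∘ Equiv.swap j (j + 1) =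
      (s ∘ Equiv.swap j (j + 1)) ∘ Equiv.swap i (i + 1) := by
    funext t
    simp only [Function.comp_apply, Equiv.swap_apply_def]
    grind
  have n1 : (s ∘ Equiv.swap i (i + 1)) j = s j := by
    simp only [Function.comp_apply]; rw [Equiv.swap_apply_of_ne_of_ne (by omega) (by omega)]
  have n2 : (s ∘ Equiv.swap i (i + 1)) (j + 1) = s (j + 1) := by
    simp only [Function.comp_apply]; rw [Equiv.swap_apply_of_ne_of_ne (by omega) (by omega)]
  have n3 : (s ∘ Equiv.swap j (j + 1)) i = s i := by
    simp only [Function.comp_apply]; rw [Equiv.swap_apply_of_ne_of_ne (by omega) (by omega)]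
  have n4 : (s ∘ Equiv.swap j (j + 1)) (i + 1) = s (i + 1) := by
    simp only [Function.comp_apply]; rw [Equiv.swap_apply_of_ne_of_ne (by omega) (by omega)]
  simp only [rOp, n1, n2, n3, n4, hc]
  ring

variable (u lam z)

/-- The functions of a sequence of row indices and a sequence of column indices. -/
abbrev BiFun (ι L : Type*) : Type _ := (ℕ → ι) → (ℕ → ι) → L

/-- The `R`-matrix acting on row indices. -/
def rowOp (i : ℕ) : Module.End L (BiFun ι L) where
  toFun g := fun I J => rOp u lam z i (fun I => g I J) I
  map_add' g g' := by
    funext I J; simp only [rOp, Pi.add_apply]; ring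
  map_smul' c g := by
    funext I J; simp only [rOp, Pi.smul_apply, smul_eq_mul, RingHom.id_apply]; ring

/-- The `R`-matrix acting on column indices. -/
def colOp (i : ℕ) : Module.End L (BiFun ι L) where
  toFun g := fun I J => rOp u lam z i (g I) J
  map_add' g g' := by
    funext I J; simp only [rOp, Pi.add_apply]; ring
  map_smul' c g := by
    funext I J; simp only [rOp, Pi.smul_apply, smul_eq_mul, RingHom.id_apply]; ring

variable {u lam z}

lemma rowOp_isHecke (hu : ∀ x y, x ≠ y → u x y * u y x = 1)
    (hlam : ∀ x, lam x * lam x = 1 + z * lam x) :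
    IsHecke (rowOp u lam z) (algebraMap L (Module.End L (BiFun ι L)) z) where
  quad i := by
    ext g I J
    exact rOp_quad hu hlam i (fun I => g I J) I
  braid i := by
    ext g I J
    exact rOp_braid hu hlam i (fun I => g I J) I
  far i j hij := by
    ext g I J
    exact rOp_far i j hij (fun I => g I J) I
  central i := Algebra.commutes _ _

lemma colOp_isHecke (hu : ∀ x y, x ≠ y → u x y * u y x = 1)
    (hlam : ∀ x, lam x * lam x = 1 + z * lam x) :
    IsHecke (colOp u lam z) (algebraMap L (Module.End L (BiFun ι L)) z) where
  quad i := by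
    ext g I J
    exact rOp_quad hu hlam i (g I) J
  braid i := by
    ext g I J
    exact rOp_braid hu hlam i (g I) J
  far i j hij := by
    ext g I J
    exact rOp_far i j hij (g I) J
  central i := Algebra.commutes _ _

lemma rowOp_colOp_comm (u u' : ι → ι → L) (lam lam' : ι → L) (z z' : L) (i j : ℕ) :
    rowOp u lam z i * colOp u' lam' z' j = colOp u' lam' z' j * rowOp u lam z i := by
  ext g I J
  change flipCoeff u lam (I i) (I (i + 1)) * (_ * g _ _ + _ * g _ _) +
    stayCoeff z (I i) (I (i + 1)) * (_ * g _ _ + _ * g _ _) =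
    flipCoeff u' lam' (J j) (J (j + 1)) * (_ * g _ _ + _ * g _ _) +
    stayCoeff z' (J j) (J (j + 1)) * (_ * g _ _ + _ * g _ _)
  ring

end RMatrix

/-! ### Scalars of the super case, and functionals from functions of words. -/

section Parameters

variable (k : Type*) [Field k] {n : ℕ} (p : Fin n → ZMod 2)

lemma sgn_add : ∀ a b : ZMod 2, sgn (a + b) = sgn a * sgn b := by decide

lemma sg_add (a b : ZMod 2) : sg k n (a + b) = sg k n a * sg k n b := by
  simp [sg, sgn_add]

lemma sg_zero : sg k n 0 = 1 := by simp [sg, sgn]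

lemma sg_mul_self (a : ZMod 2) : sg k n a * sg k n a = 1 := by
  rw [← sg_add, CharTwo.add_self_eq_zero, sg_zero]

lemma qq_mul (i j : Fin n) (a b : ℤ) : qq k i j a * qq k i j b = qq k i j (a + b) := by
  simp [qq, AddMonoidAlgebra.single_mul_single, add_smul]

lemma qq_zero (i j : Fin n) : qq k i j 0 = 1 := by
  simp [qq, AddMonoidAlgebra.one_def]

lemma paramExp_swap (i j : Fin n) : paramExp j i = -paramExp i j := by
  unfold paramExp
  rcases lt_trichotomy i j with h | rfl | h
  · simp [h, h.not_gt]
  · simp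
  · simp [h, h.not_gt]

lemma qq_swap (i j : Fin n) (a : ℤ) : qq k j i a = qq k i j (-a) := by
  simp [qq, paramExp_swap i j]

lemma qs_mul (s : Fin n) (a b : ℤ) : qs k p s a * qs k p s b = qs k p s (a + b) := by
  simp [qs, AddMonoidAlgebra.single_mul_single, add_mul]

lemma qs_zero (s : Fin n) : qs k p s 0 = 1 := by
  simp [qs, AddMonoidAlgebra.one_def]

/-- The power `q^m`. -/
def qPow (n : ℕ) (m : ℤ) : LRing k n := AddMonoidAlgebra.single (Finsupp.single none m) 1

/-- The element `q - q⁻¹`. -/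
def qDiff (n : ℕ) : LRing k n := qPow k n 1 - qPow k n (-1)

lemma zmod_two_cases (a : ZMod 2) : a = 0 ∨ a = 1 := by
  revert a; decide

lemma qs_of_even {s : Fin n} (h : p s = 0) (m : ℤ) : qs k p s m = qPow k n m := by
  simp [qs, qPow, h, sgn]

lemma qs_of_odd {s : Fin n} (h : p s = 1) (m : ℤ) : qs k p s m = qPow k n (-m) := by
  simp [qs, qPow, h, sgn]

lemma sg_one : sg k n 1 = -1 := by simp [sg, sgn]

/-- The sign compensates for `q_s = q⁻¹` at odd `s`. This makes the Hecke parameter the same for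
letters of both parities. -/
lemma qDiff_eq (s : Fin n) : qDiff k n = sg k n (p s) * (qs k p s 1 - qs k p s (-1)) := by
  rcases zmod_two_cases (p s) with h | h
  · simp [qs_of_even k p h, h, sg_zero, qDiff]
  · simp [qs_of_odd k p h, h, sg_one, qDiff]

/-- The eigenvalue of the `R`-matrix on the square of a basis vector. -/
def eig (s : Fin n) : LRing k n := sg k n (p s) * qs k p s 1

/-- The inverse of `eig`. -/
def eigInv (s : Fin n) : LRing k n := sg k n (p s) * qs k p s (-1)

lemma eig_mul_eigInv (s : Fin n) : eig k p s * eigInv k p s = 1 := by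
  have h1 := sg_mul_self k (n := n) (p s)
  have h2 := qs_mul k p s 1 (-1)
  rw [add_neg_cancel, qs_zero] at h2
  unfold eig eigInv
  linear_combination (qs k p s 1 * qs k p s (-1)) * h1 + h2

lemma eig_sub_eigInv (s : Fin n) : eig k p s - eigInv k p s = qDiff k n := by
  rw [qDiff_eq k p s, eig, eigInv]; ring

lemma eig_quad (s : Fin n) : eig k p s * eig k p s = 1 + qDiff k n * eig k p s := by
  rw [← eig_sub_eigInv k p s]
  linear_combination eig_mul_eigInv k p s

/-- The flip coefficients `(-1)^{p(x)p(y)} q_{xy}^m`. -/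
def braidCoeff (m : ℤ) (x y : Fin n) : LRing k n := sg k n (p x * p y) * qq k x y m

lemma braidCoeff_mul_swap (m : ℤ) (x y : Fin n) :
    braidCoeff k p m x y * braidCoeff k p m y x = 1 := by
  have h1 := sg_mul_self k (n := n) (p x * p y)
  have h2 := qq_mul k x y m (-m)
  rw [add_neg_cancel, qq_zero] at h2
  unfold braidCoeff
  rw [qq_swap k x y, mul_comm (p y)]
  linear_combination (qq k x y m * qq k x y (-m)) * h1 + h2

/-- The action of the row `R`-matrix. -/
abbrev rowR (i : ℕ) : Module.End (LRing k n) (BiFun (Fin n) (LRing k n)) :=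
  rowOp (braidCoeff k p 1) (eig k p) (qDiff k n) i

/-- The action of the column `R`-matrix. -/
abbrev colR (i : ℕ) : Module.End (LRing k n) (BiFun (Fin n) (LRing k n)) :=
  colOp (braidCoeff k p (-1)) (eig k p) (qDiff k n) i

lemma rowR_isHecke : IsHecke (rowR k p) (algebraMap _ _ (qDiff k n)) :=
  rowOp_isHecke (fun x y _ => braidCoeff_mul_swap k p 1 x y) (eig_quad k p)

lemma colR_isHecke : IsHecke (colR k p) (algebraMap _ _ (qDiff k n)) :=
  colOp_isHecke (fun x y _ => braidCoeff_mul_swap k p (-1) x y) (eig_quad k p)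

/-- The quadratic relations `x_s x_t = α x_t x_s + β x_{s'} x_{t'}`. -/
inductive QuadRel : (s t s' t' : Fin n × Fin n) → (α β : LRing k n) → Prop
  | sq (i j : Fin n) (hp : par p i j = 1) : QuadRel (i, j) (i, j) (i, j) (i, j) 0 0
  | row (i j h : Fin n) (hjh : j < h) :
      QuadRel (i, j) (i, h) (i, j) (i, h)
        (sg k n (par p i j * par p i h) * qs k p i 1 * qq k j h (-1)) 0
  | col (i h j : Fin n) (hih : i < h) :
      QuadRel (i, j) (h, j) (i, j) (h, j)
        (sg k n (par p i j * par p h j) * qs k p j 1 * qq k i h 1) 0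
  | anti (i j h l : Fin n) (hih : i < h) (hlj : l < j) :
      QuadRel (i, j) (h, l) (i, j) (h, l)
        (sg k n (par p i j * par p h l) * qq k i h 1 * qq k j l (-1)) 0
  | diag (i j h l : Fin n) (hih : i < h) (hjl : j < l) :
      QuadRel (i, j) (h, l) (i, l) (h, j)
        (sg k n (par p i j * par p h l) * qq k i h 1 * qq k j l (-1))
        (sg k n (par p i j * par p i l) * (qs k p i 1 - qs k p i (-1)) * qq k j l (-1))

/-- The functions of words that respect the defining relations. -/
def relFun : Submodule (LRing k n) (List (Fin n × Fin n) → LRing k n) where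
  carrier := {f | ∀ u v s t s' t' α β, QuadRel k p s t s' t' α β →
    f (u ++ s :: t :: v) = α * f (u ++ t :: s :: v) + β * f (u ++ s' :: t' :: v)}
  add_mem' {f g} hf hg := by
    intro u v s t s' t' α β h
    simp only [Pi.add_apply, hf u v s t s' t' α β h, hg u v s t s' t' α β h]; ring
  zero_mem' := by intro u v s t s' t' α β h; simp
  smul_mem' c f hf := by
    intro u v s t s' t' α β h
    simp only [Pi.smul_apply, smul_eq_mul, hf u v s t s' t' α β h]; ring

/-- A letter acts on `relFun` by translation. -/
def translate (s : Fin n × Fin n) : Module.End (LRing k n) (relFun k p) where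
  toFun f := ⟨fun w => f.1 (w ++ [s]), by
    intro u v a b a' b' α β h
    simpa using f.2 u (v ++ [s]) a b a' b' α β h⟩
  map_add' f g := rfl
  map_smul' c f := rfl

variable {k p}

lemma translate_apply (s : Fin n × Fin n) (f : relFun k p) (w : List (Fin n × Fin n)) :
    (translate k p s f).1 w = f.1 (w ++ [s]) := rfl

/-- Letters are appended on the right, so a composite of translations reads its letters from left to
right, and the relation is the condition defining `relFun` with empty right context. -/
lemma translate_quadRel {s t s' t' : Fin n × Fin n} {α β : LRing k n}
    (h : QuadRel k p s t s' t' α β) :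
    translate k p s * translate k p t =
      α • (translate k p t * translate k p s) + β • (translate k p s' * translate k p t') := by
  refine LinearMap.ext fun f => Subtype.ext (funext fun w => ?_)
  change f.1 ((w ++ [s]) ++ [t]) =
    α * f.1 ((w ++ [t]) ++ [s]) + β * f.1 ((w ++ [s']) ++ [t'])
  simpa using f.2 w [] s t s' t' α β h

variable (k p)

/-- The action of the quantum function algebra on `relFun`. -/
def translateHom : FInt k p →ₐ[LRing k n] Module.End (LRing k n) (relFun k p) :=
  RingQuot.liftAlgHom (LRing k n) ⟨FreeAlgebra.lift (LRing k n) (translate k p), by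
    intro a b h
    cases h with
    | sq i j hp => simpa [X, pow_two] using translate_quadRel (QuadRel.sq i j hp)
    | row i j h hjh => simpa [X] using translate_quadRel (QuadRel.row i j h hjh)
    | col i h j hih => simpa [X] using translate_quadRel (QuadRel.col i h j hih)
    | anti i j h l hih hlj => simpa [X] using translate_quadRel (QuadRel.anti i j h l hih hlj)
    | diag i j h l hih hjl => simpa [X] using translate_quadRel (QuadRel.diag i j h l hih hjl)⟩

lemma translateHom_gen (s : Fin n × Fin n) : translateHom k p (gen k p s) = translate k p s := by
  simp [translateHom, gen, X]

lemma translateHom_wordProd (l w : List (Fin n × Fin n)) (f : relFun k p) :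
    (translateHom k p (wordProd (gen k p) l) f).1 w = f.1 (w ++ l) := by
  induction l generalizing w with
  | nil => simp [wordProd]
  | cons s l ih =>
    rw [wordProd_cons, map_mul, translateHom_gen, Module.End.mul_apply, translate_apply, ih]
    simp

variable {k p}

/-- The linear functional on the quantum function algebra given by a function of words that
respects the defining relations. -/
def functional (f : relFun k p) : FInt k p →ₗ[LRing k n] LRing k n :=
  (LinearMap.proj []).comp ((relFun k p).subtype.comp
    ((LinearMap.applyₗ f).comp (translateHom k p).toLinearMap))

lemma functional_wordProd (f : relFun k p) (l : List (Fin n × Fin n)) :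
    functional f (wordProd (gen k p) l) = f.1 l := by
  change (translateHom k p (wordProd (gen k p) l) f).1 [] = f.1 l
  rw [translateHom_wordProd, List.nil_append]

end Parameters

/-! ### Products over pairs of letters. -/

section PairProd

variable {κ R : Type*} [CommRing R]

/-- The product of `w x y` over the pairs `x, y` of letters of a word, `x` before `y`. -/
def pairProd (w : κ → κ → R) : List κ → R
  | [] => 1
  | x :: l => (l.map (w x)).prod * pairProd w l

/-- Changing two neighbouring letters without changing their joint interaction with the others. -/
lemma exists_pairProd_eq (w : κ → κ → R) (u v : List κ) (s t : κ) :
    ∃ c : R, ∀ s' t', (∀ y, w y s' * w y t' = w y s * w y t) →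
      (∀ y, w s' y * w t' y = w s y * w t y) →
        pairProd w (u ++ s' :: t' :: v) = c * w s' t' := by
  induction u with
  | nil =>
    refine ⟨(v.map fun y => w s y * w t y).prod * pairProd w v, fun s' t' _ h => ?_⟩
    simp only [List.nil_append, pairProd, List.map_cons, List.prod_cons, ← h, List.prod_map_mul]
    ring
  | cons a u ih =>
    obtain ⟨c, hc⟩ := ih
    refine ⟨(u.map (w a)).prod * (w a s * w a t) * (v.map (w a)).prod * c, fun s' t' h h' => ?_⟩
    simp only [List.cons_append, pairProd, hc s' t' h h', List.map_append, List.prod_append,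
      List.map_cons, List.prod_cons, ← h]
    ring

/-- The sequence of letters of a word, padded by `x`. -/
def padSeq (x : κ) (l : List κ) (a : ℕ) : κ := l.getD a x

lemma padSeq_length (x : κ) (u v : List κ) (s : κ) :
    padSeq x (u ++ s :: v) u.length = s := by
  simp [padSeq]

lemma padSeq_length_succ (x : κ) (u v : List κ) (s t : κ) :
    padSeq x (u ++ s :: t :: v) (u.length + 1) = t := by
  simp [padSeq]

lemma padSeq_swap (x : κ) (u v : List κ) (s t : κ) :
    padSeq x (u ++ s :: t :: v) ∘ Equiv.swap u.length (u.length + 1) =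
      padSeq x (u ++ t :: s :: v) := by
  funext a
  simp only [Function.comp_apply, Equiv.swap_apply_def]
  split_ifs with h1 h2
  · rw [padSeq_length_succ, h1, padSeq_length]
  · rw [padSeq_length, h2, padSeq_length_succ]
  · simp only [padSeq, List.getD_eq_getElem?_getD, List.getElem?_append]
    split_ifs with h3
    · rfl
    · obtain ⟨b, rfl⟩ : ∃ b, a = u.length + (b + 2) := ⟨a - u.length - 2, by omega⟩
      simp

end PairProd

/-! ### From agreement of the two actions to the defining relations. -/

section Commutant

variable {k : Type*} [Field k] {n : ℕ} {p : Fin n → ZMod 2}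

variable (k p) in
/-- The sign of moving the row index of one letter past the column index of another. -/
def crossSign (s t : Fin n × Fin n) : LRing k n := sg k n (p s.1 * p t.2)

/-- The function of words of length `d` given by a function of the row and column sequences. -/
def wordFun (p : Fin n → ZMod 2) (d : ℕ) (x : Fin n × Fin n) (g : BiFun (Fin n) (LRing k n))
    (l : List (Fin n × Fin n)) : LRing k n :=
  if l.length = d then
    pairProd (crossSign k p) l * g (padSeq x.1 (l.map Prod.fst)) (padSeq x.2 (l.map Prod.snd))
  else 0

/-- The interaction of two letters with a third depends only on the sum of their row parities and
the sum of their column parities. Exchanging rows or columns between neighbours therefore changes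
only their mutual sign. -/
lemma crossSign_cond {i h j l i' h' j' l' : Fin n} (hr : p i' + p h' = p i + p h)
    (hc : p j' + p l' = p j + p l) :
    (∀ y, crossSign k p y (i', j') * crossSign k p y (h', l') =
      crossSign k p y (i, j) * crossSign k p y (h, l)) ∧
    (∀ y, crossSign k p (i', j') y * crossSign k p (h', l') y =
      crossSign k p (i, j) y * crossSign k p (h, l) y) := by
  simp only [crossSign, ← sg_add, ← mul_add, ← add_mul, hr, hc]
  exact ⟨fun _ => trivial, fun _ => trivial⟩

lemma rowR_smul_apply (i : ℕ) (g : BiFun (Fin n) (LRing k n)) (I J : ℕ → Fin n) :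
    (rowR k p i • g) I J =
      rOp (braidCoeff k p 1) (eig k p) (qDiff k n) i (fun I => g I J) I := rfl

lemma colR_smul_apply (i : ℕ) (g : BiFun (Fin n) (LRing k n)) (I J : ℕ → Fin n) :
    (colR k p i • g) I J =
      rOp (braidCoeff k p (-1)) (eig k p) (qDiff k n) i (g I) J := rfl

/-- The local structure of `wordFun` at two neighbouring letters. -/
lemma wordFun_local {d : ℕ} {x : Fin n × Fin n} {g : BiFun (Fin n) (LRing k n)}
    (hg : ∀ i, i + 1 < d → rowR k p i • g = colR k p i • g) (u v : List (Fin n × Fin n))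
    (i j h l : Fin n) :
    ∃ (c : LRing k n) (G : Fin n → Fin n → Fin n → Fin n → LRing k n),
      (∀ i' h' j' l', p i' + p h' = p i + p h → p j' + p l' = p j + p l →
        wordFun p d x g (u ++ (i', j') :: (h', l') :: v) =
          c * sg k n (p i' * p l') * G i' h' j' l') ∧
      ∀ i' h' j' l',
        flipCoeff (braidCoeff k p 1) (eig k p) i' h' * G h' i' j' l' +
          stayCoeff (qDiff k n) i' h' * G i' h' j' l' =
        flipCoeff (braidCoeff k p (-1)) (eig k p) j' l' * G i' h' l' j' +
          stayCoeff (qDiff k n) j' l' * G i' h' j' l' := by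
  by_cases hd : (u ++ (i, j) :: (h, l) :: v).length = d
  · obtain ⟨c, hc⟩ := exists_pairProd_eq (crossSign k p) u v (i, j) (h, l)
    refine ⟨c, fun i' h' j' l' => g (padSeq x.1 (u.map Prod.fst ++ i' :: h' :: v.map Prod.fst))
      (padSeq x.2 (u.map Prod.snd ++ j' :: l' :: v.map Prod.snd)), ?_, ?_⟩
    · intro i' h' j' l' hr hcol
      obtain ⟨h1, h2⟩ := crossSign_cond (k := k) hr hcol
      rw [wordFun, if_pos (by simpa using hd), hc _ _ h1 h2]
      simp [crossSign]
    · intro i' h' j' l'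
      have hlen : u.length + 1 < d := by
        rw [← hd]; simp
      have key := congrFun (congrFun (hg u.length hlen)
        (padSeq x.1 (u.map Prod.fst ++ i' :: h' :: v.map Prod.fst)))
        (padSeq x.2 (u.map Prod.snd ++ j' :: l' :: v.map Prod.snd))
      rw [rowR_smul_apply, colR_smul_apply] at key
      unfold rOp at key
      have r0 := padSeq_length x.1 (u.map Prod.fst) (h' :: v.map Prod.fst) i'
      have r1 := padSeq_length_succ x.1 (u.map Prod.fst) (v.map Prod.fst) i' h'
      have r2 := padSeq_swap x.1 (u.map Prod.fst) (v.map Prod.fst) i' h'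
      have c0 := padSeq_length x.2 (u.map Prod.snd) (l' :: v.map Prod.snd) j'
      have c1 := padSeq_length_succ x.2 (u.map Prod.snd) (v.map Prod.snd) j' l'
      have c2 := padSeq_swap x.2 (u.map Prod.snd) (v.map Prod.snd) j' l'
      rw [List.length_map] at r0 r1 r2 c0 c1 c2
      rw [r0, r1, r2, c0, c1, c2] at key
      exact key
  · refine ⟨0, 0, fun i' h' j' l' _ _ => ?_, by simp⟩
    rw [wordFun, if_neg (by simpa using hd)]
    simp

/-- The eigenvalue is `q` at an even index and `-q⁻¹` at an odd one; at `q = 1` they are `1` and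
`-1`, distinct in characteristic zero. -/
lemma eig_sub_eig_ne_zero [CharZero k] {i j : Fin n} (hp : par p i j = 1) :
    eig k p i - eig k p j ≠ 0 := by
  intro h
  have h' := congrArg (AddMonoidAlgebra.lift k k (Param n →₀ ℤ) 1) h
  unfold par at hp
  rcases zmod_two_cases (p i) with hi | hi <;> rcases zmod_two_cases (p j) with hj | hj <;>
    simp [eig, qs, hi, hj, sg_zero, sg_one, AddMonoidAlgebra.lift_single] at h' hp
  · norm_num at h'

/-- Elements on which the row and column actions agree respect the defining relations. -/
lemma wordFun_mem_relFun [CharZero k] {d : ℕ} {x : Fin n × Fin n}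
    {g : BiFun (Fin n) (LRing k n)}
    (hg : ∀ i, i + 1 < d → rowR k p i • g = colR k p i • g) :
    wordFun p d x g ∈ relFun k p := by
  intro u v s t s' t' α β hrel
  cases hrel with
  | sq i j hp =>
    obtain ⟨c, G, hG, hR⟩ := wordFun_local (x := x) hg u v i j i j
    simp only [hG i i j j rfl rfl, zero_mul, add_zero]
    -- On equal rows and equal columns both `R`-matrices act by scalars, and these differ when
    -- `x_ij` is odd. This is where `x_ij ^ 2 = 0` comes from.
    have h1 := hR i i j j
    simp only [flipCoeff, stayCoeff, lt_irrefl, if_true] at h1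
    have h2 : (eig k p i - eig k p j) * G i i j j = 0 := by
      rw [sub_mul, sub_eq_zero]
      simpa using h1
    have : G i i j j = 0 := (mul_eq_zero.1 h2).resolve_left (eig_sub_eig_ne_zero hp)
    rw [this, mul_zero]
  | row i j h hjh =>
    obtain ⟨c, G, hG, hR⟩ := wordFun_local (x := x) hg u v i j i h
    rw [hG i i j h rfl rfl, hG i i h j rfl (add_comm _ _), zero_mul, add_zero]
    have h1 := hR i i j h
    simp only [flipCoeff, stayCoeff, lt_irrefl, hjh, hjh.ne, if_true, if_false] at h1
    have h2 : G i i j h = eig k p i * braidCoeff k p (-1) j h * G i i h j := by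
      linear_combination (eig k p i) * h1 - (G i i j h) * eig_quad k p i
    -- The `R`-matrices supply row-row and column-column signs; the cross signs on both sides supply
    -- the mixed ones, completing the sign of the presentation.
    have h3 : sg k n (p i * p h) * (sg k n (p i) * sg k n (p j * p h)) =
        sg k n (par p i j * par p i h) * sg k n (p i * p j) := by
      simp only [← sg_add, par]; congr 1
      generalize p i = a; generalize p j = b; generalize p h = e
      revert a b e; decide
    rw [h2, eig, braidCoeff]
    linear_combination (c * qs k p i 1 * qq k j h (-1) * G i i h j) * h3
  | col i h j hih =>
    obtain ⟨c, G, hG, hR⟩ := wordFun_local (x := x) hg u v i j h j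
    rw [hG i h j j rfl rfl, hG h i j j (add_comm _ _) rfl, zero_mul, add_zero]
    have h1 := hR i h j j
    simp only [flipCoeff, stayCoeff, lt_irrefl, hih, hih.ne, if_true, if_false] at h1
    have h2 : G i h j j = eig k p j * braidCoeff k p 1 i h * G h i j j := by
      linear_combination (- eig k p j) * h1 - (G i h j j) * eig_quad k p j
    have h3 : sg k n (p i * p j) * (sg k n (p j) * sg k n (p i * p h)) =
        sg k n (par p i j * par p h j) * sg k n (p h * p j) := by
      simp only [← sg_add, par]; congr 1
      generalize p i = a; generalize p j = b; generalize p h = e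
      revert a b e; decide
    rw [h2, eig, braidCoeff]
    linear_combination (c * qs k p j 1 * qq k i h 1 * G h i j j) * h3
  | anti i j h l hih hlj =>
    obtain ⟨c, G, hG, hR⟩ := wordFun_local (x := x) hg u v i j h l
    rw [hG i h j l rfl rfl, hG h i l j (add_comm _ _) (add_comm _ _), zero_mul, add_zero]
    -- With both pairs increasing, the unflipped terms on the two sides cancel.
    have h1 := hR i h l j
    simp only [flipCoeff, stayCoeff, hih, hlj, hih.ne, hlj.ne, if_true, if_false] at h1
    have h2 : G i h j l = braidCoeff k p 1 i h * braidCoeff k p (-1) j l * G h i l j := by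
      linear_combination (-braidCoeff k p (-1) j l) * h1 -
        (G i h j l) * braidCoeff_mul_swap k p (-1) j l
    have h3 : sg k n (p i * p l) * (sg k n (p i * p h) * sg k n (p j * p l)) =
        sg k n (par p i j * par p h l) * sg k n (p h * p j) := by
      simp only [← sg_add, par]; congr 1
      generalize p i = a; generalize p j = b; generalize p h = e; generalize p l = f
      revert a b e f; decide
    rw [h2, braidCoeff, braidCoeff]
    linear_combination (c * qq k i h 1 * qq k j l (-1) * G h i l j) * h3
  | diag i j h l hih hjl =>
    obtain ⟨c, G, hG, hR⟩ := wordFun_local (x := x) hg u v i j h l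
    rw [hG i h j l rfl rfl, hG h i l j (add_comm _ _) (add_comm _ _),
      hG i h l j rfl (add_comm _ _)]
    -- Two instances are needed: `h2` expresses `G i h j l` through `G h i l j` and the unwanted `G
    -- h i j l`, and `h1` trades the latter for `G i h l j`.
    have h1 := hR i h j l
    simp only [flipCoeff, stayCoeff, hih, hjl, hih.ne, hjl.ne, if_true, if_false] at h1
    have h2 := hR h i j l
    simp only [flipCoeff, stayCoeff, hih.not_gt, hjl, hih.ne', hjl.ne, if_true, if_false] at h2
    have h3 : G i h j l = braidCoeff k p 1 i h * braidCoeff k p (-1) j l * G h i l j +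
        qDiff k n * braidCoeff k p (-1) j l * G i h l j := by
      linear_combination (braidCoeff k p 1 i h) * h2 + (qDiff k n) * h1 -
        (G i h j l) * braidCoeff_mul_swap k p 1 i h
    have h4 : sg k n (p i * p l) * (sg k n (p i * p h) * sg k n (p j * p l)) =
        sg k n (par p i j * par p h l) * sg k n (p h * p j) := by
      simp only [← sg_add, par]; congr 1
      generalize p i = a; generalize p j = b; generalize p h = e; generalize p l = f
      revert a b e f; decide
    have h5 : sg k n (p i * p l) * (sg k n (p i) * sg k n (p j * p l)) =
        sg k n (par p i j * par p i l) * sg k n (p i * p j) := by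
      simp only [← sg_add, par]; congr 1
      generalize p i = a; generalize p j = b; generalize p h = e; generalize p l = f
      revert a b e f; decide
    rw [h3, braidCoeff, braidCoeff, qDiff_eq k p i]
    linear_combination (c * qq k i h 1 * qq k j l (-1) * G h i l j) * h4 +
      (c * (qs k p i 1 - qs k p i (-1)) * qq k j l (-1) * G i h l j) * h5

end Commutant

/-! ### Specialization to `1` and control of signs. -/

section Specialization

variable (k : Type*) [Field k] {n : ℕ} (p : Fin n → ZMod 2)

/-- The specialization of all indeterminates to `1`. -/
def aug (n : ℕ) : LRing k n →ₐ[k] k := AddMonoidAlgebra.lift k k (Param n →₀ ℤ) 1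

lemma aug_single (m : Param n →₀ ℤ) : aug k n (AddMonoidAlgebra.single m 1) = 1 := by
  simp [aug, AddMonoidAlgebra.lift_single]

lemma aug_sg (a : ZMod 2) : aug k n (sg k n a) = (sgn a : k) := by simp [sg]

lemma aug_qDiff : aug k n (qDiff k n) = 0 := by
  rw [qDiff, map_sub, qPow, qPow, aug_single, aug_single, sub_self]

lemma aug_flipCoeff (m : ℤ) (x y : Fin n) :
    aug k n (flipCoeff (braidCoeff k p m) (eig k p) x y) = (sgn (p x * p y) : k) := by
  unfold flipCoeff
  split_ifs with h
  · subst h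
    rw [eig, map_mul, aug_sg, qs, aug_single, mul_one]
    congr 2
    generalize p x = a
    revert a; decide
  · rw [braidCoeff, map_mul, aug_sg, qq, aug_single, mul_one]

lemma aug_stayCoeff (x y : Fin n) : aug k n (stayCoeff (qDiff k n) x y) = 0 := by
  unfold stayCoeff
  split_ifs
  · exact aug_qDiff k
  · exact map_zero _

/-- At `q = 1` the unflipped terms vanish, leaving the simultaneous transposition of rows and
columns with its two Koszul signs. -/
lemma aug_smul (i : ℕ) (g : BiFun (Fin n) (LRing k n)) (I J : ℕ → Fin n) :
    aug k n (((rowR k p i * colR k p i) • g) I J) =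
      (sgn (p (I i) * p (I (i + 1))) : k) * (sgn (p (J i) * p (J (i + 1))) : k) *
        aug k n (g (I ∘ Equiv.swap i (i + 1)) (J ∘ Equiv.swap i (i + 1))) := by
  rw [mul_smul, rowR_smul_apply, rOp, map_add, map_mul, map_mul, aug_flipCoeff, aug_stayCoeff,
    zero_mul, add_zero, colR_smul_apply, rOp, map_add, map_mul, map_mul, aug_flipCoeff,
    aug_stayCoeff, zero_mul, add_zero, mul_assoc]

variable {k}

/-- The sign by which two letters contribute to the sign of a word: the cross sign, and a sign
for each inversion of odd letters. -/
def inversionSign (s t : Fin n × Fin n) : ℤ :=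
  sgn (p s.1 * p t.2) *
    if par p s.1 s.2 = 1 ∧ par p t.1 t.2 = 1 ∧ toLex t < toLex s then -1 else 1

/-- The sign of a word. -/
def wordSign (l : List (Fin n × Fin n)) : ℤ := pairProd (inversionSign p) l

lemma sgn_mul_self : ∀ a : ZMod 2, sgn a * sgn a = 1 := by decide

lemma pairProd_mul_self {κ R : Type*} [CommRing R] {w : κ → κ → R}
    (hw : ∀ x y, w x y * w x y = 1) (l : List κ) : pairProd w l * pairProd w l = 1 := by
  induction l with
  | nil => simp [pairProd]
  | cons x l ih =>
    have h : (l.map (w x)).prod * (l.map (w x)).prod = 1 := by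
      rw [← List.prod_map_mul]
      simp [hw]
    rw [pairProd, mul_mul_mul_comm, h, ih, one_mul]

lemma wordSign_mul_self (l : List (Fin n × Fin n)) : wordSign p l * wordSign p l = 1 := by
  refine pairProd_mul_self (fun s t => ?_) l
  rw [inversionSign, mul_mul_mul_comm, sgn_mul_self]
  split_ifs <;> rfl

/-- The two Koszul signs multiply to the two cross signs times `(-1)^(p_s p_t)`. The last factor is
the change in odd inversions, which fails only for a repeated odd letter. -/
lemma inversionSign_swap {s t : Fin n × Fin n} (h : s = t → par p s.1 s.2 ≠ 1) :
    inversionSign p t s =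
      inversionSign p s t * (sgn (p s.1 * p t.1) * sgn (p s.2 * p t.2)) := by
  have h1 : sgn (p s.1 * p t.1) * sgn (p s.2 * p t.2) =
      sgn (p s.1 * p t.2) * sgn (p t.1 * p s.2) * sgn (par p s.1 s.2 * par p t.1 t.2) := by
    simp only [← sgn_add, par]; congr 1
    generalize p s.1 = a; generalize p s.2 = b; generalize p t.1 = c; generalize p t.2 = d
    revert a b c d; decide
  have h2 : (if par p t.1 t.2 = 1 ∧ par p s.1 s.2 = 1 ∧ toLex s < toLex t then (-1 : ℤ) else 1) =
      (if par p s.1 s.2 = 1 ∧ par p t.1 t.2 = 1 ∧ toLex t < toLex s then (-1 : ℤ) else 1) *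
        sgn (par p s.1 s.2 * par p t.1 t.2) := by
    rcases zmod_two_cases (par p s.1 s.2) with hs | hs
    · simp [hs, sgn]
    · rcases zmod_two_cases (par p t.1 t.2) with ht | ht
      · simp [ht, sgn]
      · rcases lt_trichotomy (toLex s) (toLex t) with hl | hl | hl
        · simp [hs, ht, sgn, hl, hl.not_gt]
        · exact absurd hs (h (toLex.injective hl))
        · simp [hs, ht, sgn, hl, hl.not_gt]
  have h3 := sgn_mul_self (p s.1 * p t.2)
  rw [inversionSign, inversionSign, h1, h2]
  linear_combination (-(sgn (p t.1 * p s.2) *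
    (if par p s.1 s.2 = 1 ∧ par p t.1 t.2 = 1 ∧ toLex t < toLex s then (-1 : ℤ) else 1) *
        sgn (par p s.1 s.2 * par p t.1 t.2))) * h3

/-- The words in which no odd letter is repeated. -/
def OddDistinct (l : List (Fin n × Fin n)) : Prop :=
  ∀ s : Fin n × Fin n, par p s.1 s.2 = 1 → l.count s ≤ 1

lemma wordSign_swap {u v : List (Fin n × Fin n)} {s t : Fin n × Fin n}
    (h : OddDistinct p (u ++ s :: t :: v)) :
    wordSign p (u ++ t :: s :: v) =
      wordSign p (u ++ s :: t :: v) * (sgn (p s.1 * p t.1) * sgn (p s.2 * p t.2)) := by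
  obtain ⟨c, hc⟩ := exists_pairProd_eq (inversionSign p) u v s t
  rw [wordSign, wordSign, hc s t (fun _ => rfl) (fun _ => rfl),
    hc t s (fun _ => mul_comm _ _) (fun _ => mul_comm _ _), inversionSign_swap, mul_assoc]
  rintro rfl hs
  have := h s hs
  simp at this
  omega

/-- The word of length `d` with the given rows and columns. -/
def seqWord (d : ℕ) (I J : ℕ → Fin n) : List (Fin n × Fin n) :=
  (List.range d).map fun a => (I a, J a)

lemma range_eq_append {d i : ℕ} (h : i + 1 < d) :
    List.range d = List.range i ++ i :: (i + 1) :: List.range' (i + 2) (d - (i + 2)) := by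
  obtain ⟨e, rfl⟩ : ∃ e, d = i + (e + 2) := ⟨d - i - 2, by omega⟩
  rw [List.range_eq_range', List.range_eq_range', show i + (e + 2) - (i + 2) = e by omega,
    ← List.range'_append_1]
  simp [List.range'_succ]

lemma seqWord_swap {d i : ℕ} (h : i + 1 < d) (I J : ℕ → Fin n) :
    ∃ u v, seqWord d I J = u ++ (I i, J i) :: (I (i + 1), J (i + 1)) :: v ∧
      seqWord d (I ∘ Equiv.swap i (i + 1)) (J ∘ Equiv.swap i (i + 1)) =
        u ++ (I (i + 1), J (i + 1)) :: (I i, J i) :: v := by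
  refine ⟨_, _, by rw [seqWord, range_eq_append h, List.map_append, List.map_cons, List.map_cons],
    ?_⟩
  rw [seqWord, range_eq_append h, List.map_append, List.map_cons, List.map_cons]
  simp only [Function.comp_apply, Equiv.swap_apply_left, Equiv.swap_apply_right]
  congr 1
  · refine List.map_congr_left fun a ha => ?_
    rw [List.mem_range] at ha
    rw [Equiv.swap_apply_of_ne_of_ne (by omega) (by omega)]
  · congr 2
    refine List.map_congr_left fun a ha => ?_
    rw [List.mem_range'_1] at ha
    rw [Equiv.swap_apply_of_ne_of_ne (by omega) (by omega)]

variable (k)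

/-- The functions whose specialization is supported on the rearrangements of `l₀`, and is there a
natural number times the sign of the word. -/
def positivePart (l₀ : List (Fin n × Fin n)) : AddSubmonoid (BiFun (Fin n) (LRing k n)) where
  carrier := {g | ∀ I J, ∃ m : ℕ, (wordSign p (seqWord l₀.length I J) : k) * aug k n (g I J) = m ∧
    (¬ (seqWord l₀.length I J).Perm l₀ → m = 0)}
  zero_mem' := fun I J => ⟨0, by simp, fun _ => rfl⟩
  add_mem' := by
    intro f g hf hg I J
    obtain ⟨a, ha, ha'⟩ := hf I J
    obtain ⟨b, hb, hb'⟩ := hg I J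
    refine ⟨a + b, ?_, fun h => by rw [ha' h, hb' h]⟩
    rw [Pi.add_apply, Pi.add_apply, map_add, mul_add, ha, hb, Nat.cast_add]

variable {k p}

/-- Multiplication by `wordSign` absorbs the signs of the specialized action on words without
repeated odd letters, so it becomes a plain permutation and preserves natural-number values. -/
lemma smul_mem_positivePart {l₀ : List (Fin n × Fin n)} (hl₀ : OddDistinct p l₀) {i : ℕ}
    (hi : i + 1 < l₀.length) {g : BiFun (Fin n) (LRing k n)} (hg : g ∈ positivePart k p l₀) :
    (rowR k p i * colR k p i) • g ∈ positivePart k p l₀ := by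
  intro I J
  obtain ⟨u, v, h1, h2⟩ := seqWord_swap hi I J
  obtain ⟨m, hm, hm'⟩ := hg (I ∘ Equiv.swap i (i + 1)) (J ∘ Equiv.swap i (i + 1))
  have hperm : (u ++ (I (i + 1), J (i + 1)) :: (I i, J i) :: v).Perm
      (u ++ (I i, J i) :: (I (i + 1), J (i + 1)) :: v) :=
    (List.Perm.swap _ _ _).append_left u
  rw [aug_smul, h1]
  rw [h2] at hm hm'
  by_cases hp : (u ++ (I i, J i) :: (I (i + 1), J (i + 1)) :: v).Perm l₀
  · refine ⟨m, ?_, fun h => absurd hp h⟩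
    have hod : OddDistinct p (u ++ (I i, J i) :: (I (i + 1), J (i + 1)) :: v) := by
      intro s hs
      rw [hp.count_eq]
      exact hl₀ s hs
    rw [← hm, wordSign_swap p hod]
    push_cast
    ring
  · have h0 := hm' fun h => hp (hperm.symm.trans h)
    refine ⟨0, ?_, fun _ => rfl⟩
    rw [h0, Nat.cast_zero] at hm
    have hs : (wordSign p (u ++ (I (i + 1), J (i + 1)) :: (I i, J i) :: v) : k) ≠ 0 := by
      have := wordSign_mul_self p (u ++ (I (i + 1), J (i + 1)) :: (I i, J i) :: v)
      intro h
      have h' := congrArg (Int.cast : ℤ → k) this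
      rw [Int.cast_mul, h, zero_mul, Int.cast_one] at h'
      exact zero_ne_one h'
    rw [(mul_eq_zero.1 hm).resolve_left hs, mul_zero, mul_zero, Nat.cast_zero]

lemma seqWord_padSeq (x : Fin n × Fin n) (l : List (Fin n × Fin n)) :
    seqWord l.length (padSeq x.1 (l.map Prod.fst)) (padSeq x.2 (l.map Prod.snd)) = l := by
  refine List.ext_getElem (by simp [seqWord]) fun a h1 h2 => ?_
  simp [seqWord, padSeq, List.getD_eq_getElem?_getD, h2]

/-- A functional that separates the rearrangements of a word from all other words. -/
lemma exists_relFun [CharZero k] (l₀ : List (Fin n × Fin n)) (hl₀ : OddDistinct p l₀) :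
    ∃ f : relFun k p, aug k n (f.1 l₀) ≠ 0 ∧ ∀ l, ¬ l.Perm l₀ → aug k n (f.1 l) = 0 := by
  rcases l₀ with _ | ⟨x, l₁⟩
  -- The empty word is treated apart: there is no letter to pad with when `n = 0`. Both sides of a
  -- relation involve only nonempty words.
  · refine ⟨⟨fun l => if l = [] then 1 else 0, ?_⟩, ?_, ?_⟩
    · intro u v s t s' t' α β _
      simp
    · simp
    · intro l hl
      have : l ≠ [] := by rintro rfl; exact hl (List.Perm.refl _)
      simp [this]
  · generalize hl : x :: l₁ = l₀ at *
    let g₀ : BiFun (Fin n) (LRing k n) := fun I J =>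
      if seqWord l₀.length I J = l₀ then (wordSign p l₀ : LRing k n) else 0
    have hsq : (wordSign p l₀ : k) * (wordSign p l₀ : k) = 1 := by
      rw [← Int.cast_mul, wordSign_mul_self, Int.cast_one]
    have hg₀ : g₀ ∈ positivePart k p l₀ := by
      intro I J
      by_cases h : seqWord l₀.length I J = l₀
      · refine ⟨1, ?_, fun h' => absurd (List.Perm.of_eq h) h'⟩
        simp only [g₀, h, if_true, map_intCast, hsq, Nat.cast_one]
      · exact ⟨0, by simp [g₀, h], fun _ => rfl⟩
    obtain ⟨y, hy, hyP⟩ := exists_agree (rowR_isHecke k p) (colR_isHecke k p)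
      (fun i j => rowOp_colOp_comm _ _ _ _ _ _ i j) (positivePart k p l₀) (l₀.length - 1)
      (fun i hi g hg => smul_mem_positivePart hl₀ (by omega) hg) g₀ hg₀
    have hword : ∀ l : List (Fin n × Fin n), l.length = l₀.length →
        aug k n (wordFun p l₀.length x y l) = aug k n (pairProd (crossSign k p) l) *
          aug k n (y (padSeq x.1 (l.map Prod.fst)) (padSeq x.2 (l.map Prod.snd))) := by
      intro l hl
      rw [wordFun, if_pos hl, map_mul]
    refine ⟨⟨wordFun p l₀.length x y, wordFun_mem_relFun fun i hi => hy i (by omega)⟩, ?_, ?_⟩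
    · rw [hword l₀ rfl]
      obtain ⟨m, hm, -⟩ := hyP (padSeq x.1 (l₀.map Prod.fst)) (padSeq x.2 (l₀.map Prod.snd))
      rw [Pi.sub_apply, Pi.sub_apply, map_sub, seqWord_padSeq, mul_sub] at hm
      simp only [g₀, seqWord_padSeq, if_true, map_intCast, hsq] at hm
      intro h
      rcases mul_eq_zero.1 h with h | h
      · have h1 := pairProd_mul_self (w := crossSign k p) (fun s t => sg_mul_self k _) l₀
        have h2 := congrArg (aug k n) h1
        rw [map_mul, h, zero_mul, map_one] at h2
        exact zero_ne_one h2
      -- The signed value at `l₀` is `1 + m`: `1` from the starting function and `m` from the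
      -- averaging.
      · rw [h, mul_zero, zero_sub] at hm
        have : ((m + 1 : ℕ) : k) = 0 := by
          push_cast
          rw [← hm]; ring
        exact absurd (Nat.cast_eq_zero.1 this) (by omega)
    · intro l hl
      change aug k n (wordFun p l₀.length x y l) = 0
      by_cases hlen : l.length = l₀.length
      · rw [hword l hlen]
        obtain ⟨m, hm, hm0⟩ := hyP (padSeq x.1 (l.map Prod.fst)) (padSeq x.2 (l.map Prod.snd))
        rw [← hlen, seqWord_padSeq] at hm hm0
        have hne : l ≠ l₀ := by rintro rfl; exact hl (List.Perm.refl _)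
        rw [hm0 hl, Pi.sub_apply, Pi.sub_apply, Nat.cast_zero] at hm
        simp only [g₀, ← hlen, seqWord_padSeq, hne, if_false, sub_zero] at hm
        have hs : (wordSign p l : k) ≠ 0 := by
          intro h
          have h' := congrArg (Int.cast : ℤ → k) (wordSign_mul_self p l)
          rw [Int.cast_mul, h, zero_mul, Int.cast_one] at h'
          exact zero_ne_one h'
        rw [(mul_eq_zero.1 hm).resolve_left hs, mul_zero]
      · rw [wordFun, if_neg hlen, map_zero]

end Specialization

/-! ### Independence, spanning and the basis. -/

section Basis

/-- A family is linearly independent if some functionals on it form a matrix that becomes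
diagonal, with nonzero diagonal entries, under a specialization of the scalars. -/
lemma linearIndependent_of_specialization {R S M ι : Type*} [CommRing R] [IsDomain R]
    [CommRing S] [IsDomain S] [AddCommMonoid M] [Module R M] (σ : R →+* S) (v : ι → M)
    (φ : ι → M →ₗ[R] R) (hdiag : ∀ i, σ (φ i (v i)) ≠ 0)
    (hoff : ∀ i j, i ≠ j → σ (φ i (v j)) = 0) : LinearIndependent R v := by
  classical
  let := Module.addCommMonoidToAddCommGroup R (M := M)
  rw [linearIndependent_iff']
  intro s c hc i hi
  let A : Matrix s s R := fun i j => φ i.1 (v j.1)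
  have hA : σ.mapMatrix A = Matrix.diagonal fun i : s => σ (φ i.1 (v i.1)) := by
    ext i j
    by_cases h : i = j
    · subst h
      rw [RingHom.mapMatrix_apply, Matrix.map_apply, Matrix.diagonal_apply_eq]
    · rw [Matrix.diagonal_apply_ne _ h]
      exact hoff i.1 j.1 fun h' => h (Subtype.ext h')
  have hdet : A.det ≠ 0 := by
    intro h
    have h' := RingHom.map_det σ A
    rw [h, map_zero, hA, Matrix.det_diagonal] at h'
    exact Finset.prod_ne_zero_iff.2 (fun i _ => hdiag i.1) h'.symm
  have hmul : A.mulVec (fun j : s => c j.1) = 0 := by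
    funext i
    have := congrArg (φ i.1) hc
    rw [map_sum, map_zero, ← Finset.sum_coe_sort] at this
    simp only [map_smul, smul_eq_mul] at this
    simp only [Matrix.mulVec, dotProduct, A, Pi.zero_apply]
    rw [← this]
    exact Finset.sum_congr rfl fun j _ => mul_comm _ _
  exact congrFun (Matrix.eq_zero_of_mulVec_eq_zero hdet hmul) ⟨i, hi⟩

variable (k : Type*) [Field k] {n : ℕ} (p : Fin n → ZMod 2)

lemma monomial_eq_wordProd (ord : LinearOrder (Fin n × Fin n)) (e : TruncExp p) :
    monomial k p ord e = wordProd (gen k p) (expWord ord e.1) :=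
  orderedProd_eq_wordProd ord (gen k p) e.1

/-- Distinct exponents give words that are not rearrangements of each other, so the functionals of
`exists_relFun` form a matrix that is diagonal after specialization. -/
lemma linearIndependent_monomial [CharZero k] (ord : LinearOrder (Fin n × Fin n)) :
    LinearIndependent (LRing k n) (monomial k p ord) := by
  have hodd : ∀ e : TruncExp p, OddDistinct p (expWord ord e.1) := by
    intro e s hs
    exact (count_expWord ord e.1 s).le.trans (e.2 s.1 s.2 hs)
  choose f hf hf0 using fun e : TruncExp p => exists_relFun (k := k) (expWord ord e.1) (hodd e)
  refine linearIndependent_of_specialization (aug k n).toRingHom _ (fun e => functional (f e))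
    (fun e => ?_) (fun e e' h => ?_)
  · rw [monomial_eq_wordProd, functional_wordProd]
    exact hf e
  · rw [monomial_eq_wordProd, functional_wordProd]
    refine hf0 e _ fun hperm => h (Subtype.ext (funext fun s => ?_))
    exact (count_expWord ord e.1 s).symm.trans
      ((hperm.count_eq s).symm.trans (count_expWord ord e'.1 s))

variable {k p}

lemma isUnit_sg (a : ZMod 2) : IsUnit (sg k n a) := .of_mul_eq_one _ (sg_mul_self k a)

lemma isUnit_qq (i j : Fin n) (m : ℤ) : IsUnit (qq k i j m) :=
  .of_mul_eq_one (qq k i j (-m)) (by rw [qq_mul, add_neg_cancel, qq_zero])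

lemma isUnit_qs (s : Fin n) (m : ℤ) : IsUnit (qs k p s m) :=
  .of_mul_eq_one (qs k p s (-m)) (by rw [qs_mul, add_neg_cancel, qs_zero])

/-- The weight of a generator. -/
def genWeight (s : Fin n × Fin n) : ℕ := s.1 * s.2

lemma gen_quadRel {s t s' t' : Fin n × Fin n} {α β : LRing k n} (h : QuadRel k p s t s' t' α β) :
    gen k p s * gen k p t = α • (gen k p t * gen k p s) + β • (gen k p s' * gen k p t') := by
  simp only [gen, ← map_mul, ← map_smul, ← map_add]
  cases h with
  | sq i j hp => simpa [pow_two] using RingQuot.mkAlgHom_rel (LRing k n) (Rel.sq (k := k) i j hp)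
  | row i j h hjh => simpa using RingQuot.mkAlgHom_rel (LRing k n) (Rel.row (k := k) i j h hjh)
  | col i h j hih => simpa using RingQuot.mkAlgHom_rel (LRing k n) (Rel.col (k := k) i h j hih)
  | anti i j h l hih hlj =>
    simpa using RingQuot.mkAlgHom_rel (LRing k n) (Rel.anti (k := k) i j h l hih hlj)
  | diag i j h l hih hjl =>
    simpa using RingQuot.mkAlgHom_rel (LRing k n) (Rel.diag (k := k) i j h l hih hjl)

/-- Elements satisfying the quadratic relations commute up to a unit and terms of lower weight. -/
lemma exists_unit_swap {A : Type*} [Ring A] [Algebra (LRing k n) A] {y : Fin n × Fin n → A}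
    (hy : ∀ {s t s' t' : Fin n × Fin n} {α β : LRing k n}, QuadRel k p s t s' t' α β →
      y s * y t = α • (y t * y s) + β • (y s' * y t')) (s t : Fin n × Fin n) :
    ∃ c : LRing k n, IsUnit c ∧ y s * y t - c • (y t * y s) ∈
      lowSpan (LRing k n) y genWeight (genWeight s + genWeight t) := by
  have of_eq : ∀ {s t s' t' : Fin n × Fin n} {α : LRing k n}, QuadRel k p s t s' t' α 0 →
      y s * y t - α • (y t * y s) ∈
        lowSpan (LRing k n) y genWeight (genWeight s + genWeight t) := by
    intro s t s' t' α h
    rw [hy h, zero_smul, add_zero, sub_self]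
    exact zero_mem _
  -- Each relation is given for one order of its two letters; a unit coefficient lets it be solved
  -- for the other product.
  have symm : ∀ {s t : Fin n × Fin n}, (∃ c : LRing k n, IsUnit c ∧
      y s * y t - c • (y t * y s) ∈
        lowSpan (LRing k n) y genWeight (genWeight s + genWeight t)) →
      ∃ c : LRing k n, IsUnit c ∧ y t * y s - c • (y s * y t) ∈
        lowSpan (LRing k n) y genWeight (genWeight t + genWeight s) := by
    rintro s t ⟨c, ⟨c, rfl⟩, hc⟩
    refine ⟨↑c⁻¹, c⁻¹.isUnit, ?_⟩
    rw [add_comm (genWeight t)]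
    have := Submodule.smul_mem _ (-(↑c⁻¹ : LRing k n)) hc
    rwa [smul_sub, smul_smul, neg_mul, Units.inv_mul, neg_smul, neg_smul, one_smul,
      sub_neg_eq_add, neg_add_eq_sub] at this
  have lt_case : ∀ i h : Fin n, i < h → ∀ j l : Fin n, ∃ c : LRing k n, IsUnit c ∧
      y (i, j) * y (h, l) - c • (y (h, l) * y (i, j)) ∈
        lowSpan (LRing k n) y genWeight (genWeight (i, j) + genWeight (h, l)) := by
    intro i h hih j l
    rcases lt_trichotomy j l with hjl | rfl | hlj
    · refine ⟨sg k n (par p i j * par p h l) * qq k i h 1 * qq k j l (-1),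
        ((isUnit_sg _).mul (isUnit_qq _ _ _)).mul (isUnit_qq _ _ _), ?_⟩
      · rw [hy (QuadRel.diag i j h l hih hjl), add_sub_cancel_left]
        refine Submodule.smul_mem _ _ (Submodule.subset_span ⟨[(i, l), (h, j)], ?_, ?_⟩)
        -- With `h = i + a + 1` and `l = j + b + 1`, the weight drops by `(a + 1) * (b + 1)`.
        · obtain ⟨a, ha⟩ := Nat.exists_eq_add_of_lt (Fin.lt_def.1 hih)
          obtain ⟨b, hb⟩ := Nat.exists_eq_add_of_lt (Fin.lt_def.1 hjl)
          simp only [wordWeight, genWeight, List.map_cons, List.map_nil, List.sum_cons,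
            List.sum_nil, ha, hb]
          nlinarith
        · simp [wordProd]
    · exact ⟨_, ((isUnit_sg _).mul (isUnit_qs _ _)).mul (isUnit_qq _ _ _),
        of_eq (QuadRel.col i h j hih)⟩
    · exact ⟨_, ((isUnit_sg _).mul (isUnit_qq _ _ _)).mul (isUnit_qq _ _ _),
        of_eq (QuadRel.anti i j h l hih hlj)⟩
  have row_case : ∀ i j l : Fin n, j < l → ∃ c : LRing k n, IsUnit c ∧
      y (i, j) * y (i, l) - c • (y (i, l) * y (i, j)) ∈
        lowSpan (LRing k n) y genWeight (genWeight (i, j) + genWeight (i, l)) :=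
    fun i j l hjl => ⟨_, ((isUnit_sg _).mul (isUnit_qs _ _)).mul (isUnit_qq _ _ _),
      of_eq (QuadRel.row i j l hjl)⟩
  obtain ⟨i, j⟩ := s
  obtain ⟨h, l⟩ := t
  rcases lt_trichotomy i h with hih | rfl | hih
  · exact lt_case i h hih j l
  · rcases lt_trichotomy j l with hjl | rfl | hlj
    · exact row_case i j l hjl
    · exact ⟨1, isUnit_one, by simp⟩
    · exact symm (row_case i l j hlj)
  · exact symm (lt_case h i hih l j)

lemma wordProd_mem_span_of_quadRel {A : Type*} [Semiring A] [Algebra (LRing k n) A]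
    {y : Fin n × Fin n → A}
    (hy : ∀ {s t s' t' : Fin n × Fin n} {α β : LRing k n}, QuadRel k p s t s' t' α β →
      y s * y t = α • (y t * y s) + β • (y s' * y t'))
    (ord : LinearOrder (Fin n × Fin n)) (l : List (Fin n × Fin n)) :
    wordProd y l ∈ Submodule.span (LRing k n)
      (Set.range fun e : TruncExp p => wordProd y (expWord ord e.1)) := by
  let : Ring A := Algebra.semiringToRing (LRing k n)
  have := wordProd_mem_span (R := LRing k n) ord y genWeight
    {s | par p s.1 s.2 = 1} (fun s t => (exists_unit_swap (p := p) hy s t).imp fun _ h => h.2)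
    (fun s hs => by simpa using hy (QuadRel.sq s.1 s.2 hs)) l
  refine Submodule.span_mono ?_ this
  rintro _ ⟨e, he, rfl⟩
  exact ⟨⟨e, fun i j h => he (i, j) h⟩, rfl⟩

variable (k p) in
lemma mem_span_wordProd (a : FInt k p) :
    a ∈ Submodule.span (LRing k n) (Set.range (wordProd (gen k p))) := by
  obtain ⟨a, rfl⟩ := RingQuot.mkAlgHom_surjective (LRing k n) (Rel k p) a
  induction a using FreeAlgebra.induction with
  | grade0 r =>
    rw [AlgHom.commutes, Algebra.algebraMap_eq_smul_one]
    exact Submodule.smul_mem _ _ (Submodule.subset_span ⟨[], rfl⟩)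
  | grade1 s => exact Submodule.subset_span ⟨[s], by simp [wordProd, gen, X]⟩
  | mul a b ha hb =>
    rw [map_mul]
    have := Submodule.mul_mem_mul ha hb
    rw [Submodule.span_mul_span] at this
    refine Submodule.span_mono ?_ this
    rintro _ ⟨_, ⟨u, rfl⟩, _, ⟨v, rfl⟩, rfl⟩
    exact ⟨u ++ v, wordProd_append _ _ _⟩
  | add a b ha hb =>
    rw [map_add]
    exact add_mem ha hb

variable (k p) in
lemma span_monomial (ord : LinearOrder (Fin n × Fin n)) :
    ⊤ ≤ Submodule.span (LRing k n) (Set.range (monomial k p ord)) := by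
  intro a _
  refine Submodule.span_le.2 ?_ (mem_span_wordProd k p a)
  rintro _ ⟨l, rfl⟩
  have := wordProd_mem_span_of_quadRel (gen_quadRel (k := k) (p := p)) ord l
  rwa [← funext fun e => monomial_eq_wordProd k p ord e] at this

variable (k p) in
/-- The basis of truncated ordered monomials. -/
def monomialBasis [CharZero k] (ord : LinearOrder (Fin n × Fin n)) :
    Module.Basis (TruncExp p) (LRing k n) (FInt k p) :=
  Module.Basis.mk (linearIndependent_monomial k p ord) (span_monomial k p ord)

end Basis

end QMat

end

theorem theorem4p12 (k : Type*) [Field k] [CharZero k] (n : ℕ) (p : Fin n → ZMod 2)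
    (ord : LinearOrder (Fin n × Fin n)) :
    (∃ b : Module.Basis (QMat.TruncExp p) (QMat.LRing k n) (QMat.FInt k p),
      ∀ e, b e = QMat.monomial k p ord e) ∧
    Module.Free (QMat.LRing k n) (QMat.FInt k p) ∧
    (∃ b : Module.Basis (QMat.TruncExp p) (QMat.LField k n) (QMat.FRat k p),
      ∀ e, b e = (1 : QMat.LField k n) ⊗ₜ[QMat.LRing k n] QMat.monomial k p ord e) := by
  have hb : ∀ e, QMat.monomialBasis k p ord e = QMat.monomial k p ord e :=
    fun e => Module.Basis.mk_apply _ _ e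
  refine ⟨⟨QMat.monomialBasis k p ord, hb⟩, .of_basis (QMat.monomialBasis k p ord),
    (QMat.monomialBasis k p ord).baseChange (QMat.LField k n), fun e => ?_⟩
  rw [Module.Basis.baseChange_apply, hb]
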